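/- In the adjacency array model, an undirected simple graph on the vertex set $[n]$ is given by its degrees $d_1,\dots,d_n$, which an algorithm gets for free, and by arrays $f_i:[d_i]\to[n]$, where $f_i(j)$ is the $j$-th neighbour of vertex $i$ in an arbitrary fixed numbering. A quantum query algorithm alternates input-independent unitary operators, which may depend on $n$ and on the degrees, with queries $|i,j\rangle|z\rangle\mapsto|i,j\rangle|z+f_i(j) \bmod n\rangle$ (which may be controlled), and finally measures; only the queries are counted. For every constant $\varepsilon<1/2$ there are a constant $c>0$ and an integer $N$ such that, for every $n\ge N$, every quantum query algorithm in this model that decides with error probability at most $\varepsilon$ on every $n$-vertex input graph whether the graph is bipartite makes at least $cn$ queries on some $n$-vertex input graph. The same holds for every such algorithm that decides whether the input graph contains a cycle. That is, bipartiteness testing and cycle detection both require $\Omega(n)$ quantum queries in the adjacency array model. -/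

import Mathlib

namespace QuantumGraph

/-- An undirected simple graph on the vertex set `Fin n`, given by adjacency arrays: vertex `i` has
degree `d i`, and `nbr i j` is its `j`-th neighbour, in an arbitrary fixed numbering. -/
structure AdjacencyArray (n : ℕ) (d : Fin n → ℕ) where
  nbr : (i : Fin n) → Fin (d i) → Fin n
  injective : ∀ i, Function.Injective (nbr i)
  loopless : ∀ i j, nbr i j ≠ i
  symmetric : ∀ i j, ∃ j', nbr (nbr i j) j' = i

/-- The graph that the adjacency arrays describe. -/
def AdjacencyArray.toGraph {n : ℕ} {d : Fin n → ℕ} (x : AdjacencyArray n d) :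
    SimpleGraph (Fin n) where
  Adj i k := ∃ j, x.nbr i j = k
  symm := ⟨by
    rintro i _ ⟨j, rfl⟩
    exact x.symmetric i j⟩
  loopless := ⟨by
    rintro i ⟨j, h⟩
    exact x.loopless i j h⟩

/-- Computational basis states `|q, z, a⟩`. The query register `q` holds a position `(i, j)` of the
arrays, or `none` (no query is made in this branch); the answer register `z` holds an integer
modulo `n`; the workspace has dimension `w`. -/
abbrev BasisState (n : ℕ) (d : Fin n → ℕ) (w : ℕ) : Type :=
  Option (Σ i : Fin n, Fin (d i)) × Fin n × Fin w

/-- The query operator `|(i, j), z, a⟩ ↦ |(i, j), z + nbr i j mod n, a⟩`, `|none, z, a⟩ ↦ |none, z, a⟩`,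
acting on vectors of amplitudes. -/
def AdjacencyArray.oracle {n : ℕ} {d : Fin n → ℕ} {w : ℕ} (x : AdjacencyArray n d)
    (ψ : BasisState n d w → ℂ) : BasisState n d w → ℂ
  | (none, z, a) => ψ (none, z, a)
  | (some q, z, a) => ψ (some q, z - x.nbr q.1 q.2, a)

/-- A quantum query algorithm for `n`-vertex graphs whose degree sequence is `d`: it starts in a
basis state and applies `U₀, O, U₁, O, …, O, U_T`, where `T` is the number of queries, `O` is
the query operator and `U_k` is `unitary k` (those with `k > T` are not used); then it measures in
the computational basis and accepts if the outcome lies in `accept`. -/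
structure QueryAlgorithm (n : ℕ) (d : Fin n → ℕ) where
  queries : ℕ
  workspace : ℕ
  start : BasisState n d workspace
  unitary : ℕ → Matrix.unitaryGroup (BasisState n d workspace) ℂ
  accept : Finset (BasisState n d workspace)

/-- The state after `k` queries and the unitary that follows the last of them. -/
def QueryAlgorithm.state {n : ℕ} {d : Fin n → ℕ} (A : QueryAlgorithm n d)
    (x : AdjacencyArray n d) : ℕ → BasisState n d A.workspace → ℂ
  | 0 => Matrix.mulVec (A.unitary 0).1 (Pi.single A.start 1)
  | k + 1 => Matrix.mulVec (A.unitary (k + 1)).1 (x.oracle (A.state x k))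

/-- The probability that the algorithm accepts the input `x`. -/
noncomputable def QueryAlgorithm.acceptProb {n : ℕ} {d : Fin n → ℕ} (A : QueryAlgorithm n d)
    (x : AdjacencyArray n d) : ℝ :=
  ∑ s ∈ A.accept, ‖A.state x A.queries s‖ ^ 2

/-- The algorithm `A`, which is given the degree sequence for free and so may depend on it, decides
the property `P` of `n`-vertex graphs with error probability at most `ε` on every input. -/
def Decides {n : ℕ} (A : (d : Fin n → ℕ) → QueryAlgorithm n d)
    (P : SimpleGraph (Fin n) → Prop) (ε : ℝ) : Prop :=
  ∀ (d : Fin n → ℕ) (x : AdjacencyArray n d),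
    (P x.toGraph → 1 - ε ≤ (A d).acceptProb x) ∧ (¬ P x.toGraph → (A d).acceptProb x ≤ ε)

/-- Every quantum query algorithm that decides `P` with error at most `ε` in the adjacency array
model makes `Ω(n)` queries on some `n`-vertex input. -/
def RequiresLinearQueries (P : (n : ℕ) → SimpleGraph (Fin n) → Prop) (ε : ℝ) : Prop :=
  ∃ c : ℝ, 0 < c ∧ ∃ N : ℕ, ∀ n : ℕ, N ≤ n →
    ∀ A : (d : Fin n → ℕ) → QueryAlgorithm n d, Decides A (P n) ε →
      ∃ d : Fin n → ℕ, Nonempty (AdjacencyArray n d) ∧ c * (n : ℝ) ≤ ((A d).queries : ℝ)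

end QuantumGraph

/-! ### Functions of low degree and the parity character -/

namespace QuantumGraph

/-! The proof is the polynomial method applied to parity. Hide `m` bits in a graph so that each
array entry depends on one bit and the degrees on none. After `t` queries the amplitudes have degree
at most `t` in the bits, so the acceptance probability has degree at most twice the number of
queries (`acceptProb_mem_lowDegree`). Parity is orthogonal to all functions of degree below `m`, so
computing it takes at least `m / 2` queries (`le_two_mul_queries`).

The graph is a ladder of two tracks that cross where a bit is `1`, with one edge joining the end of
track `0` to its start. For odd parity the tracks and this edge form a single path; for even parity
the edge closes a cycle of length `m + 1`, which is odd for even `m`. Hence bipartiteness and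
acyclicity both reveal the parity, with `m` about `n / 2`. -/

/-- The span of the functions of `m` bits that depend on at most `k` of them, that is, the
functions whose multilinear representation has degree at most `k`. -/
def lowDegree (m k : ℕ) : Submodule ℂ ((Fin m → Bool) → ℂ) :=
  Submodule.span ℂ {f | ∃ S : Finset (Fin m), S.card ≤ k ∧ DependsOn f (S : Set (Fin m))}

theorem mem_lowDegree_of_dependsOn {m k : ℕ} {f : (Fin m → Bool) → ℂ} (S : Finset (Fin m))
    (hS : S.card ≤ k) (hf : DependsOn f (S : Set (Fin m))) : f ∈ lowDegree m k :=
  Submodule.subset_span ⟨S, hS, hf⟩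

theorem const_mem_lowDegree (m k : ℕ) (c : ℂ) : (fun _ => c) ∈ lowDegree m k :=
  mem_lowDegree_of_dependsOn ∅ (by simp) (by simpa using dependsOn_const c)

theorem lowDegree_mono (m : ℕ) {k l : ℕ} (h : k ≤ l) : lowDegree m k ≤ lowDegree m l :=
  Submodule.span_mono fun _ ⟨S, hS, hf⟩ => ⟨S, hS.trans h, hf⟩

theorem mul_mem_lowDegree {m k l : ℕ} {f g : (Fin m → Bool) → ℂ} (hf : f ∈ lowDegree m k)
    (hg : g ∈ lowDegree m l) : f * g ∈ lowDegree m (k + l) := by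
  have h := Submodule.mul_mem_mul hf hg
  rw [lowDegree, lowDegree, Submodule.span_mul_span] at h
  refine Submodule.span_mono ?_ h
  rintro _ ⟨f, ⟨S, hS, hf⟩, g, ⟨T, hT, hg⟩, rfl⟩
  refine ⟨S ∪ T, (Finset.card_union_le _ _).trans (add_le_add hS hT), fun x y hxy => ?_⟩
  have hfx : f x = f y := hf fun i hi => hxy i (by simp_all)
  have hgx : g x = g y := hg fun i hi => hxy i (by simp_all)
  simp [hfx, hgx]

theorem star_mem_lowDegree {m k : ℕ} {f : (Fin m → Bool) → ℂ} (hf : f ∈ lowDegree m k) :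
    star f ∈ lowDegree m k := by
  induction hf using Submodule.span_induction with
  | mem f hf =>
    obtain ⟨S, hS, hf⟩ := hf
    exact mem_lowDegree_of_dependsOn S hS fun x y hxy => congrArg star (hf hxy)
  | zero => simp
  | add f g _ _ hf hg => simpa using add_mem hf hg
  | smul c f _ hf => simpa using Submodule.smul_mem _ (star c) hf

/-- The parity character of a string of bits. -/
def paritySign {m : ℕ} (x : Fin m → Bool) : ℂ := ∏ i, if x i then -1 else 1

theorem paritySign_update_not {m : ℕ} (x : Fin m → Bool) (i : Fin m) :
    paritySign (Function.update x i (!x i)) = -paritySign x := by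
  unfold paritySign
  rw [← Finset.mul_prod_erase _ _ (Finset.mem_univ i),
    ← Finset.mul_prod_erase Finset.univ (fun j => if x j then (-1 : ℂ) else 1) (Finset.mem_univ i),
    ← neg_mul]
  congr 1
  · cases h : x i <;> simp
  · refine Finset.prod_congr rfl fun j hj => ?_
    rw [Function.update_of_ne (Finset.ne_of_mem_erase hj)]

theorem update_not_involutive {m : ℕ} (i : Fin m) :
    Function.Involutive fun x : Fin m → Bool => Function.update x i (!x i) := by
  intro x
  simp

/-- Some bit is ignored by a spanning `f`; flipping it preserves `f` and negates the sign, so the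
terms cancel in pairs. -/
theorem sum_paritySign_mul_eq_zero {m k : ℕ} (hk : k < m) {f : (Fin m → Bool) → ℂ}
    (hf : f ∈ lowDegree m k) : ∑ x, paritySign x * f x = 0 := by
  induction hf using Submodule.span_induction with
  | mem f hf =>
    obtain ⟨S, hS, hf⟩ := hf
    obtain ⟨i, -, hi⟩ : ∃ i ∈ Finset.univ, i ∉ S :=
      Finset.exists_mem_notMem_of_card_lt_card (by simpa using hS.trans_lt hk)
    have h := Equiv.sum_comp (update_not_involutive i).toPerm fun x => paritySign x * f x
    have hfx (x) : f (Function.update x i (!x i)) = f x := hf fun j hj => by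
      rw [Function.update_of_ne]
      rintro rfl
      exact hi hj
    simp only [Function.Involutive.coe_toPerm, paritySign_update_not, hfx, neg_mul,
      Finset.sum_neg_distrib] at h
    exact self_eq_neg.mp h.symm
  | zero => simp
  | add f g _ _ hf hg => simp [mul_add, Finset.sum_add_distrib, hf, hg]
  | smul c f _ hf => simp [mul_left_comm, ← Finset.mul_sum, hf]

/-! ### The polynomial method for query algorithms -/

section Family

variable {n m : ℕ} {d : Fin n → ℕ} (X : (Fin m → Bool) → AdjacencyArray n d)

theorem state_mem_lowDegree
    (hX : ∀ i j, ∃ k : Fin m, DependsOn (fun x => (X x).nbr i j) {k})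
    (A : QueryAlgorithm n d) (t : ℕ) (s : BasisState n d A.workspace) :
    (fun x => A.state (X x) t s) ∈ lowDegree m t := by
  induction t generalizing s with
  | zero => exact const_mem_lowDegree _ _ _
  | succ t ih =>
    have h (r : BasisState n d A.workspace) :
        (fun x => (X x).oracle (A.state (X x) t) r) ∈ lowDegree m (t + 1) := by
      obtain ⟨_ | q, z, a⟩ := r
      · exact lowDegree_mono m t.le_succ (ih _)
      -- Splitting by the value `y` of the queried entry gives old amplitudes times indicators of a
      -- single bit, so the degree grows by one.
      · have hsum : (fun x => (X x).oracle (A.state (X x) t) (some q, z, a)) =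
            ∑ y, (fun x => A.state (X x) t (some q, z - y, a)) *
              fun x => if (X x).nbr q.1 q.2 = y then (1 : ℂ) else 0 := by
          ext x
          simp [AdjacencyArray.oracle]
        rw [hsum]
        refine sum_mem fun y _ => mul_mem_lowDegree (ih _) ?_
        obtain ⟨k, hk⟩ := hX q.1 q.2
        refine mem_lowDegree_of_dependsOn {k} (by simp) fun x x' hx => ?_
        have : (X x).nbr q.1 q.2 = (X x').nbr q.1 q.2 := hk (by simpa using hx)
        simp [this]
    have hsum : (fun x => A.state (X x) (t + 1) s) =
        ∑ r, (A.unitary (t + 1)).1 s r • fun x => (X x).oracle (A.state (X x) t) r := by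
      ext x
      simp [QueryAlgorithm.state, Matrix.mulVec, dotProduct]
    rw [hsum]
    exact sum_mem fun r _ => Submodule.smul_mem _ _ (h r)

theorem acceptProb_mem_lowDegree
    (hX : ∀ i j, ∃ k : Fin m, DependsOn (fun x => (X x).nbr i j) {k})
    (A : QueryAlgorithm n d) :
    (fun x => (A.acceptProb (X x) : ℂ)) ∈ lowDegree m (A.queries + A.queries) := by
  have hsum : (fun x => (A.acceptProb (X x) : ℂ)) =
      ∑ s ∈ A.accept, (fun x => A.state (X x) A.queries s) *
        star fun x => A.state (X x) A.queries s := by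
    ext x
    simp [QueryAlgorithm.acceptProb, Complex.mul_conj']
  rw [hsum]
  exact sum_mem fun s _ => mul_mem_lowDegree (state_mem_lowDegree X hX A _ s)
    (star_mem_lowDegree (state_mem_lowDegree X hX A _ s))

/-- An algorithm that computes the parity of `m` bits hidden in a family of adjacency arrays, each
entry of which depends on a single bit, makes at least `m / 2` queries. -/
theorem le_two_mul_queries
    (hX : ∀ i j, ∃ k : Fin m, DependsOn (fun x => (X x).nbr i j) {k})
    (A : QueryAlgorithm n d) {ε : ℝ} (hε : ε < 1 / 2) {σ : ℂ} (hσ : σ = 1 ∨ σ = -1)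
    (hacc : ∀ x, paritySign x = σ → 1 - ε ≤ A.acceptProb (X x))
    (hrej : ∀ x, paritySign x = -σ → A.acceptProb (X x) ≤ ε) : m ≤ 2 * A.queries := by
  by_contra! hm
  rw [two_mul] at hm
  have hsign (x : Fin m → Bool) : paritySign x = σ ∨ paritySign x = -σ := by
    have : paritySign x = 1 ∨ paritySign x = -1 := by
      refine Finset.prod_induction _ (fun c : ℂ => c = 1 ∨ c = -1) ?_ (Or.inl rfl) ?_
      · rintro _ _ (rfl | rfl) (rfl | rfl) <;> simp
      · intro i _
        split_ifs <;> simp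
    rcases hσ with rfl | rfl
    · exact this
    · simpa using this.symm
  have hσσ : σ * σ = 1 := by rcases hσ with rfl | rfl <;> norm_num
  -- Multiplied by `σ`, every term of this vanishing sum is at least `1 / 2 - ε > 0`.
  have h := sum_paritySign_mul_eq_zero hm <| sub_mem (acceptProb_mem_lowDegree X hX A)
    (const_mem_lowDegree m _ (1 / 2))
  have hre := congrArg (fun c : ℂ => (σ * c).re) h
  simp only [Finset.mul_sum, ← mul_assoc, mul_zero, Complex.re_sum, Complex.zero_re] at hre
  refine (Finset.sum_pos (fun x _ => ?_) Finset.univ_nonempty).ne' hre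
  rcases hsign x with hx | hx
  · have := hacc x hx
    simp [hx, hσσ]
    linarith
  · have := hrej x hx
    simp [hx, hσσ]
    linarith

end Family

/-- The highest vertex of a cycle would have two distinct neighbours, both exactly one lower. -/
theorem isAcyclic_of_injective_of_adj {V : Type*} {G : SimpleGraph V} (h : V → ℕ)
    (hinj : Function.Injective h)
    (hadj : ∀ v w, G.Adj v w → h w = h v + 1 ∨ h v = h w + 1) : G.IsAcyclic := by
  classical
  intro v c hc
  obtain ⟨u, hu, hmax⟩ := c.support.toFinset.exists_max_image h ⟨v, by simp⟩
  rw [List.mem_toFinset] at hu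
  have hc' := hc.rotate (hu := hu)
  have key (w : V) (hw : w ∈ (c.rotate _ hu).support) (huw : G.Adj u w) : h u = h w + 1 := by
    have := hmax w (by simpa using (c.mem_support_rotate_iff _ hu).mp hw)
    have := hadj u w huw
    omega
  have h₁ := key (c.rotate _ hu).snd (SimpleGraph.Walk.getVert_mem_support _ _)
    ((c.rotate _ hu).adj_snd hc'.not_nil)
  have h₂ := key (c.rotate _ hu).penultimate (SimpleGraph.Walk.getVert_mem_support _ _)
    ((c.rotate _ hu).adj_penultimate hc'.not_nil).symm
  exact hc'.snd_ne_penultimate (hinj (by omega))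

/-! ### The hard instances -/

section Ladder

/-! The vertex `2 * i + b` is the copy `b` of layer `i ≤ m`. It is joined to the copy `b + y i` of
layer `i + 1`, for bits `y i`, and the copy `0` of layer `m` is joined to the copy `0` of layer
`0`. -/

/-- The neighbour of `v` in the layer after its own. -/
def ladderNext (m : ℕ) (y : ℕ → ℕ) (v : ℕ) : ℕ :=
  if v = 2 * m then 0 else 2 * (v / 2 + 1) + (v % 2 + y (v / 2)) % 2

/-- The neighbour of `v` in the layer before its own. -/
def ladderPrev (m : ℕ) (y : ℕ → ℕ) (v : ℕ) : ℕ :=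
  if v = 0 then 2 * m else 2 * (v / 2 - 1) + (v % 2 + y (v / 2 - 1)) % 2

/-- The number of neighbours of `v`: the copies `1` of the first and the last layer have just one. -/
def ladderDegree (m v : ℕ) : ℕ :=
  if v < 2 * m + 2 then if v = 1 ∨ v = 2 * m + 1 then 1 else 2 else 0

/-- The arrays list the previous neighbour first, except that vertex `1` has only a next one. -/
def ladderNbr (m : ℕ) (y : ℕ → ℕ) (v j : ℕ) : ℕ :=
  if j = 0 ∧ v ≠ 1 then ladderPrev m y v else ladderNext m y v

variable {m : ℕ} {y : ℕ → ℕ}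

theorem ladderNext_spec {v : ℕ} (hv : v < 2 * m + 2) (hv' : v ≠ 2 * m + 1) :
    ladderNext m y v < 2 * m + 2 ∧ ladderNext m y v ≠ 1 ∧
      ladderPrev m y (ladderNext m y v) = v := by
  by_cases h : v = 2 * m
  · simp [ladderNext, ladderPrev, h]
  · have h₂ : (2 * (v / 2 + 1) + (v % 2 + y (v / 2)) % 2) / 2 - 1 = v / 2 := by omega
    simp only [ladderNext, ladderPrev, h, if_false, h₂]
    split_ifs <;> omega

theorem ladderPrev_spec {v : ℕ} (hv : v < 2 * m + 2) (hv' : v ≠ 1) :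
    ladderPrev m y v < 2 * m + 2 ∧ ladderPrev m y v ≠ 2 * m + 1 ∧
      ladderNext m y (ladderPrev m y v) = v := by
  by_cases h : v = 0
  · simp [ladderNext, ladderPrev, h]
  · have h₂ : (2 * (v / 2 - 1) + (v % 2 + y (v / 2 - 1)) % 2) / 2 = v / 2 - 1 := by omega
    simp only [ladderNext, ladderPrev, h, if_false, h₂]
    split_ifs <;> omega

/-- The layers are cyclically ordered and number `m + 1 ≥ 3`, so the two neighbours lie in different
layers. -/
theorem ladderPrev_ne_ladderNext (hm : 2 ≤ m) {v : ℕ} :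
    ladderPrev m y v ≠ ladderNext m y v := by
  simp only [ladderPrev, ladderNext]
  split_ifs <;> omega

theorem ladderNbr_ne_self (hm : 2 ≤ m) {v j : ℕ} :
    ladderNbr m y v j ≠ v := by
  simp only [ladderNbr, ladderPrev, ladderNext]
  split_ifs <;> omega

theorem exists_ladderNbr_eq_iff (hm : 2 ≤ m) {v w : ℕ} :
    (∃ j < ladderDegree m v, ladderNbr m y v j = w) ↔
      v < 2 * m + 2 ∧ (v ≠ 1 ∧ ladderPrev m y v = w ∨ v ≠ 2 * m + 1 ∧ ladderNext m y v = w) := by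
  simp only [ladderDegree, ladderNbr]
  constructor
  · rintro ⟨j, hj, h⟩
    split_ifs at hj h <;> grind
  · rintro ⟨hv, ⟨h₁, h⟩ | ⟨h₁, h⟩⟩
    · exact ⟨0, by split_ifs <;> omega, by simpa [h₁] using h⟩
    · by_cases h₂ : v = 1
      · exact ⟨0, by simp [h₂], by simpa [h₂] using h⟩
      · exact ⟨1, by split_ifs <;> omega, by simpa using h⟩

/-- The bits of `x`, followed by zeros. -/
def bit (x : Fin m → Bool) (i : ℕ) : ℕ := if h : i < m then (x ⟨i, h⟩).toNat else 0

theorem exists_bit_congr (hm : 2 ≤ m) (i : ℕ) :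
    ∃ k : Fin m, ∀ x x' : Fin m → Bool, x k = x' k → bit x i = bit x' i := by
  by_cases h : i < m
  · exact ⟨⟨i, h⟩, fun x x' hx => by simp [bit, h, hx]⟩
  · exact ⟨⟨0, by omega⟩, fun x x' _ => by simp [bit, h]⟩

variable {n : ℕ}

/-- The adjacency arrays of the graph that hides the bits `x`. -/
def ladder (hm : 2 ≤ m) (hn : 2 * m + 2 ≤ n) (x : Fin m → Bool) :
    AdjacencyArray n (fun v => ladderDegree m v) where
  nbr v j := ⟨ladderNbr m (bit x) v j, by
    obtain ⟨hv, ⟨hv', h⟩ | ⟨hv', h⟩⟩ := (exists_ladderNbr_eq_iff hm).mp ⟨j, j.2, rfl⟩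
    · exact h ▸ (ladderPrev_spec hv hv').1.trans_le hn
    · exact h ▸ (ladderNext_spec hv hv').1.trans_le hn⟩
  injective v j j' h := by
    have hj := j.2
    have hj' := j'.2
    simp only [Fin.mk.injEq, ladderNbr] at h
    simp only [ladderDegree] at hj hj'
    have := @ladderPrev_ne_ladderNext m (bit x) hm v
    ext
    grind
  loopless _ _ h := ladderNbr_ne_self hm (congrArg Fin.val h)
  symmetric v j := by
    have h := (exists_ladderNbr_eq_iff (y := bit x) hm).mp ⟨j, j.2, rfl⟩
    set w := ladderNbr m (bit x) v j
    suffices h' : ∃ j' < ladderDegree m w, ladderNbr m (bit x) w j' = v by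
      obtain ⟨j', hj', h'⟩ := h'
      exact ⟨⟨j', hj'⟩, Fin.ext h'⟩
    rw [exists_ladderNbr_eq_iff hm]
    obtain ⟨hv, ⟨hv', h⟩ | ⟨hv', h⟩⟩ := h
    · rw [← h]
      have := ladderPrev_spec (y := bit x) hv hv'
      exact ⟨this.1, Or.inr this.2⟩
    · rw [← h]
      have := ladderNext_spec (y := bit x) hv hv'
      exact ⟨this.1, Or.inl this.2⟩

theorem ladder_dependsOn (hm : 2 ≤ m) (hn : 2 * m + 2 ≤ n) (v : Fin n)
    (j : Fin (ladderDegree m v)) :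
    ∃ k : Fin m, DependsOn (fun x => (ladder hm hn x).nbr v j) {k} := by
  by_cases h : (j : ℕ) = 0 ∧ (v : ℕ) ≠ 1
  · obtain ⟨k, hk⟩ := exists_bit_congr hm (v / 2 - 1)
    refine ⟨k, fun x x' hx => Fin.ext ?_⟩
    simp only [ladder, ladderNbr, if_pos h, ladderPrev, hk x x' (hx k rfl)]
  · obtain ⟨k, hk⟩ := exists_bit_congr hm (v / 2)
    refine ⟨k, fun x x' hx => Fin.ext ?_⟩
    simp only [ladder, ladderNbr, if_neg h, ladderNext, hk x x' (hx k rfl)]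

theorem ladder_adj_iff (hm : 2 ≤ m) (hn : 2 * m + 2 ≤ n) (x : Fin m → Bool) (v w : Fin n) :
    (ladder hm hn x).toGraph.Adj v w ↔ (v : ℕ) < 2 * m + 2 ∧
      ((v : ℕ) ≠ 1 ∧ ladderPrev m (bit x) v = w ∨
        (v : ℕ) ≠ 2 * m + 1 ∧ ladderNext m (bit x) v = w) := by
  rw [← exists_ladderNbr_eq_iff hm]
  constructor
  · rintro ⟨j, h⟩
    exact ⟨j, j.2, congrArg Fin.val h⟩
  · rintro ⟨j, hj, h⟩
    exact ⟨⟨j, hj⟩, Fin.ext h⟩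

/-- The parity of the first `i` of the bits `y`. -/
def prefixParity (y : ℕ → ℕ) (i : ℕ) : ℕ := (∑ k ∈ Finset.range i, y k) % 2

theorem prefixParity_zero : prefixParity y 0 = 0 := by simp [prefixParity]

theorem prefixParity_succ (i : ℕ) :
    prefixParity y (i + 1) = (prefixParity y i + y i) % 2 := by
  simp [prefixParity, Finset.sum_range_succ]

theorem prefixParity_lt (i : ℕ) : prefixParity y i < 2 := Nat.mod_lt _ two_pos

theorem paritySign_eq (x : Fin m → Bool) : paritySign x = (-1) ^ prefixParity (bit x) m := by
  rw [prefixParity, ← neg_one_pow_eq_pow_mod_two, Finset.sum_range, ← Finset.prod_pow_eq_pow_sum,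
    paritySign]
  refine Finset.prod_congr rfl fun i _ => ?_
  cases h : x i <;> simp [bit, h]

/-- The position of `v` on the path that the graph is when the parity of the bits is odd. -/
def ladderPosition (m : ℕ) (y : ℕ → ℕ) (v : ℕ) : ℕ :=
  if v < 2 * m + 2 then
    if v % 2 = prefixParity y (v / 2) then m + 1 + v / 2 else v / 2
  else v

theorem ladderPosition_injective : Function.Injective (ladderPosition m y) := by
  intro v w h
  have hw := prefixParity_lt (y := y) (w / 2)
  simp only [ladderPosition] at h
  by_cases hvw : v / 2 = w / 2
  · rw [hvw] at h
    split_ifs at h <;> omega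
  · split_ifs at h <;> omega

theorem ladderPosition_next (hodd : prefixParity y m = 1) {v : ℕ} (hv : v < 2 * m + 2)
    (hv' : v ≠ 2 * m + 1) : ladderPosition m y (ladderNext m y v) = ladderPosition m y v + 1 := by
  by_cases h : v = 2 * m
  -- For odd parity the closing edge links the path from vertex `1`, ending at position `m`, to the
  -- path from vertex `0`, starting at `m + 1`.
  · simp [ladderNext, ladderPosition, h, hodd, prefixParity_zero]
  · have h₂ : (2 * (v / 2 + 1) + (v % 2 + y (v / 2)) % 2) / 2 = v / 2 + 1 := by omega
    have := prefixParity_lt (y := y) (v / 2)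
    simp only [ladderNext, ladderPosition, h, if_false, h₂, prefixParity_succ]
    split_ifs <;> omega

theorem ladder_isAcyclic (hm : 2 ≤ m) (hn : 2 * m + 2 ≤ n) {x : Fin m → Bool}
    (hodd : prefixParity (bit x) m = 1) : (ladder hm hn x).toGraph.IsAcyclic := by
  refine isAcyclic_of_injective_of_adj (fun v => ladderPosition m (bit x) v)
    (ladderPosition_injective.comp Fin.val_injective) fun v w h => ?_
  obtain ⟨hv, ⟨hv', h⟩ | ⟨hv', h⟩⟩ := (ladder_adj_iff hm hn x v w).mp h
  · obtain ⟨h₁, h₂, h₃⟩ := ladderPrev_spec (y := bit x) hv hv'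
    right
    rw [← h]
    simpa [h₃] using ladderPosition_next hodd h₁ h₂
  · left
    rw [← h]
    exact ladderPosition_next hodd hv hv'

theorem ladder_not_isBipartite (hm : 2 ≤ m) (hn : 2 * m + 2 ≤ n) (hm' : Even m)
    {x : Fin m → Bool} (heven : prefixParity (bit x) m = 0) :
    ¬ (ladder hm hn x).toGraph.IsBipartite := by
  rintro ⟨c⟩
  have hlt (i : ℕ) (hi : i ≤ m) : 2 * i + prefixParity (bit x) i < n := by
    have := prefixParity_lt (y := bit x) i
    omega
  -- Colours alternate along the path from vertex `0`, so its ends agree for even `m`; even parity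
  -- makes them adjacent.
  have key (i : ℕ) (hi : i ≤ m) :
      (c ⟨_, hlt i hi⟩ : ℕ) = ((c ⟨_, hlt 0 m.zero_le⟩ : ℕ) + i) % 2 := by
    induction i with
    | zero => omega
    | succ i ih =>
      have := prefixParity_lt (y := bit x) i
      have hadj := (ladder_adj_iff hm hn x ⟨_, hlt i (by omega)⟩ ⟨_, hlt (i + 1) hi⟩).mpr <| by
        have h₁ : (2 * i + prefixParity (bit x) i) / 2 = i := by omega
        refine ⟨by simp only; omega, Or.inr ⟨by simp only; omega, ?_⟩⟩
        simp only [ladderNext, h₁, prefixParity_succ]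
        rw [if_neg (by omega)]
        omega
      have hne := Fin.val_ne_of_ne (c.valid hadj)
      have := ih (by omega)
      omega
  have hadj := (ladder_adj_iff hm hn x ⟨_, hlt m le_rfl⟩ ⟨_, hlt 0 m.zero_le⟩).mpr <| by
    refine ⟨by simp only; omega, Or.inr ⟨by simp only; omega, ?_⟩⟩
    simp [ladderNext, heven, prefixParity_zero]
  have hne := Fin.val_ne_of_ne (c.valid hadj)
  have := key m le_rfl
  have := (c ⟨_, hlt 0 m.zero_le⟩).2
  obtain ⟨k, rfl⟩ := hm'
  omega

theorem paritySign_eq_neg_one_iff (x : Fin m → Bool) :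
    paritySign x = -1 ↔ prefixParity (bit x) m = 1 := by
  rw [paritySign_eq]
  have := prefixParity_lt (y := bit x) m
  interval_cases prefixParity (bit x) m <;> norm_num

/-- Forests are bipartite, so the odd cycle also settles acyclicity. -/
theorem ladder_isAcyclic_iff (hm : 2 ≤ m) (hn : 2 * m + 2 ≤ n) (hm' : Even m)
    (x : Fin m → Bool) : (ladder hm hn x).toGraph.IsAcyclic ↔ paritySign x = -1 := by
  rw [paritySign_eq_neg_one_iff]
  refine ⟨fun h => ?_, ladder_isAcyclic hm hn⟩
  have := mt (ladder_not_isBipartite hm hn hm' (x := x)) (not_not.mpr h.isBipartite)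
  have := prefixParity_lt (y := bit x) m
  omega

theorem ladder_isBipartite_iff (hm : 2 ≤ m) (hn : 2 * m + 2 ≤ n) (hm' : Even m)
    (x : Fin m → Bool) : (ladder hm hn x).toGraph.IsBipartite ↔ paritySign x = -1 := by
  refine ⟨fun h => ?_, fun h => ((ladder_isAcyclic_iff hm hn hm' x).mpr h).isBipartite⟩
  rw [paritySign_eq_neg_one_iff]
  have := mt (ladder_not_isBipartite hm hn hm' (x := x)) (not_not.mpr h)
  have := prefixParity_lt (y := bit x) m
  omega

end Ladder

/-- A property that tells the parity of the bits hidden in a ladder requires linearly many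
queries. -/
theorem requiresLinearQueries_of_ladder {P : (n : ℕ) → SimpleGraph (Fin n) → Prop} {ε : ℝ}
    (hε : ε < 1 / 2) {σ : ℂ} (hσ : σ = 1 ∨ σ = -1)
    (hP : ∀ {n m : ℕ} (hm : 2 ≤ m) (hn : 2 * m + 2 ≤ n), Even m → ∀ x : Fin m → Bool,
      P n (ladder hm hn x).toGraph ↔ paritySign x = σ) :
    RequiresLinearQueries P ε := by
  -- Take the largest even `m` with `2 * m + 2 ≤ n`; `n ≥ 6` makes `m ≥ 2`. Then `m ≤ 2 * q` gives
  -- `n ≤ 4 * q + 5 ≤ 9 * q`, as `q ≥ 1`.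
  refine ⟨1 / 9, by norm_num, 6, fun n hn A hA => ?_⟩
  have hm : 2 ≤ 2 * ((n - 2) / 4) := by omega
  have hn' : 2 * (2 * ((n - 2) / 4)) + 2 ≤ n := by omega
  have hP' := hP hm hn' (even_two_mul _)
  refine ⟨_, ⟨ladder hm hn' fun _ => false⟩, ?_⟩
  have hσ' : -σ ≠ σ := by rcases hσ with rfl | rfl <;> norm_num
  have hq := le_two_mul_queries (ladder hm hn') (ladder_dependsOn hm hn') (A _) hε hσ
    (fun x hx => (hA _ _).1 ((hP' x).mpr hx))
    (fun x hx => (hA _ _).2 fun h => hσ' (hx.symm.trans ((hP' x).mp h)))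
  set q := (A fun v => ladderDegree (2 * ((n - 2) / 4)) v).queries
  have : (n : ℝ) ≤ 9 * q := by exact_mod_cast (by omega : n ≤ 9 * q)
  linarith

theorem paritySign_ne_neg_one_iff {m : ℕ} (x : Fin m → Bool) :
    paritySign x ≠ -1 ↔ paritySign x = 1 := by
  rw [paritySign_eq]
  rcases neg_one_pow_eq_or ℂ (prefixParity (bit x) m) with h | h <;> rw [h] <;> norm_num

end QuantumGraph

theorem lemma3 (ε : ℝ) (hε : ε < 1 / 2) :
    QuantumGraph.RequiresLinearQueries (fun _ G => G.IsBipartite) ε ∧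
      QuantumGraph.RequiresLinearQueries (fun _ G => ¬ G.IsAcyclic) ε := by
  refine ⟨QuantumGraph.requiresLinearQueries_of_ladder hε (Or.inr rfl)
      QuantumGraph.ladder_isBipartite_iff,
    QuantumGraph.requiresLinearQueries_of_ladder hε (Or.inl rfl) fun hm hn hm' x => ?_⟩
  rw [QuantumGraph.ladder_isAcyclic_iff hm hn hm', ← QuantumGraph.paritySign_ne_neg_one_iff]
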